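/- For a compact space $X$, let $C_p(X)$ denote the set of all continuous functions $X\to\mathbb{R}$ with the topology of pointwise convergence (the subspace topology inherited from the product $\mathbb{R}^X$), and let $C_w(X)$ denote the Banach space $C(X)$ of all continuous functions $X\to\mathbb{R}$ (with the supremum norm) endowed with its weak topology. A topological space is scattered if none of its nonempty subsets is dense-in-itself, i.e. every nonempty subset has a relatively isolated point. Theorem. Let $K$ be an infinite compact Hausdorff space and let $S$ be an infinite scattered compact Hausdorff space. Then the spaces $C_p(K)$ and $C_w(S)$ are not homeomorphic. -/

import Mathlib

/-- A topological space is scattered if no nonempty subset of it is dense-in-itself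
(`Preperfect` is Mathlib's name for a dense-in-itself set). -/
def IsScattered (X : Type*) [TopologicalSpace X] : Prop :=
  ∀ A : Set X, A.Nonempty → ¬ Preperfect A

/-- `C_p(X)`: the continuous real-valued functions on `X` with the topology of pointwise
convergence, that is, the subspace topology inherited from the product `X → ℝ`. -/
abbrev Cp (X : Type*) [TopologicalSpace X] : Type _ :=
  {f : X → ℝ // Continuous f}

/-- `C_w(X)` for a compact space `X`: the Banach space `C(X, ℝ)` with its weak topology
(for compact `X`, the topology of `C(X, ℝ)` in Mathlib is that of the supremum norm). -/
abbrev Cw (X : Type*) [TopologicalSpace X] [CompactSpace X] : Type _ :=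
  WeakSpace ℝ C(X, ℝ)

/-! The Fréchet–Urysohn property separates the two spaces. `Cw S` fails it, but its norm-bounded
subsets have it: scatteredness reduces pointwise closure to countably many coordinates, and bounded
pointwise convergent sequences converge weakly by Riesz representation and dominated convergence.
Given a homeomorphism `h : Cp K ≃ₜ Cw S`, Baire category in the Banach space `C(K, ℝ)` yields a
sup-norm ball with norm-bounded image (`exists_ball_norm_le`). Since `Cp K` embeds into that ball
(`exists_isInducing_into_ball`), `Cw S` embeds into a norm-bounded subset of itself and so would be
Fréchet–Urysohn. -/

open Filter Topology MeasureTheory Set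
open scoped NNReal CompactlySupported

/-! ### Weak convergence of bounded sequences -/

/-- A continuous functional on `C(X, ℝ)` is dominated by a positive functional. -/
theorem exists_positive_majorant {X : Type*} [TopologicalSpace X] [CompactSpace X]
    (φ : C(X, ℝ) →L[ℝ] ℝ) :
    ∃ Λ : C_c(X, ℝ≥0) →ₗ[ℝ≥0] ℝ≥0, ∀ (g : C(X, ℝ)) (F : C_c(X, ℝ≥0)),
      (∀ x, |g x| ≤ F x) → |φ g| ≤ Λ F := by
  -- The supremum of `V F` is the total variation of `φ` evaluated at `F`.
  let V : C_c(X, ℝ≥0) → Set ℝ := fun F => {t | ∃ g : C(X, ℝ), (∀ x, |g x| ≤ F x) ∧ φ g = t}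
  have hne : ∀ F, (V F).Nonempty := fun F => ⟨0, 0, by simp, by simp⟩
  have hbdd : ∀ F, BddAbove (V F) := by
    intro F
    let G : C(X, ℝ) := ⟨fun x => (F x : ℝ), by fun_prop⟩
    refine ⟨‖φ‖ * ‖G‖, ?_⟩
    rintro _ ⟨g, hg, rfl⟩
    refine (le_abs_self _).trans ((φ.le_opNorm g).trans ?_)
    gcongr
    refine (ContinuousMap.norm_le _ (norm_nonneg _)).2 fun x => (hg x).trans ?_
    exact (le_abs_self _).trans (G.norm_coe_le_norm x)
  have hle : ∀ (g : C(X, ℝ)) (F : C_c(X, ℝ≥0)), (∀ x, |g x| ≤ F x) → φ g ≤ sSup (V F) :=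
    fun g F h => le_csSup (hbdd F) ⟨g, h, rfl⟩
  have h0 : ∀ F, 0 ≤ sSup (V F) := fun F => by simpa using hle 0 F (by simp)
  have hadd : ∀ F G, sSup (V (F + G)) = sSup (V F) + sSup (V G) := by
    intro F G
    apply le_antisymm
    · refine csSup_le (hne _) ?_
      rintro _ ⟨g, hg, rfl⟩
      -- Riesz decomposition: truncating `g` to `[-F, F]` leaves a remainder bounded by `G`.
      let g₁ : C(X, ℝ) := ⟨fun x => max (-(F x : ℝ)) (min (g x) (F x)), by fun_prop⟩
      have e : g = g₁ + (g - g₁) := by abel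
      rw [e, map_add]
      refine add_le_add (hle _ _ fun x => ?_) (hle _ _ fun x => ?_)
      · simp only [g₁, ContinuousMap.coe_mk, abs_le]
        exact ⟨le_max_left _ _, max_le (by linarith [(F x).coe_nonneg]) (min_le_right _ _)⟩
      · have h := hg x
        have hF := (F x).coe_nonneg
        have hG := (G x).coe_nonneg
        simp only [CompactlySupportedContinuousMap.coe_add, Pi.add_apply, NNReal.coe_add,
          abs_le] at h
        simp only [g₁, ContinuousMap.coe_sub, Pi.sub_apply, ContinuousMap.coe_mk, abs_le]
        rcases max_cases (-(F x : ℝ)) (min (g x) (F x)) with h1 | h1 <;>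
        rcases min_cases (g x) (F x : ℝ) with h2 | h2 <;> constructor <;> linarith
    · rw [← le_sub_iff_add_le]
      refine csSup_le (hne _) ?_
      rintro _ ⟨g, hg, rfl⟩
      rw [le_sub_iff_add_le, ← le_sub_iff_add_le']
      refine csSup_le (hne _) ?_
      rintro _ ⟨g', hg', rfl⟩
      rw [le_sub_iff_add_le', ← map_add]
      refine hle _ _ fun x => ?_
      simpa using (abs_add_le _ _).trans (add_le_add (hg x) (hg' x))
  have hsmul_le : ∀ (c : ℝ≥0) F, c * sSup (V F) ≤ sSup (V (c • F)) := by
    intro c F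
    rcases eq_or_ne c 0 with rfl | hc
    · simpa using h0 _
    have hc' : (0 : ℝ) < c := by positivity
    rw [← le_div_iff₀' hc']
    refine csSup_le (hne _) ?_
    rintro _ ⟨g, hg, rfl⟩
    rw [le_div_iff₀' hc', ← smul_eq_mul, ← map_smul]
    refine hle _ _ fun x => ?_
    simpa [abs_mul] using mul_le_mul_of_nonneg_left (hg x) hc'.le
  have hsmul : ∀ (c : ℝ≥0) F, sSup (V (c • F)) = c * sSup (V F) := by
    intro c F
    refine le_antisymm ?_ (hsmul_le c F)
    rcases eq_or_ne c 0 with rfl | hc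
    · have h := hadd 0 0
      rw [add_zero] at h
      have : sSup (V 0) = 0 := by linarith
      simp [this]
    · have hc' : (0 : ℝ) < c := by positivity
      have h := hsmul_le c⁻¹ (c • F)
      rw [inv_smul_smul₀ hc, NNReal.coe_inv, inv_mul_le_iff₀ hc'] at h
      exact h
  refine ⟨{ toFun := fun F => ⟨sSup (V F), h0 F⟩
            map_add' := fun F G => NNReal.eq (hadd F G)
            map_smul' := fun c F => NNReal.eq (hsmul c F) }, fun g F hg => abs_le.2 ⟨?_, hle g F hg⟩⟩
  have := hle (-g) F (by simpa using hg)
  rw [map_neg] at this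
  exact neg_le.1 this

/-- A uniformly bounded sequence in `C(X, ℝ)` that tends to zero pointwise tends to zero weakly. -/
theorem tendsto_functional_of_pointwise_zero {X : Type*} [TopologicalSpace X] [CompactSpace X]
    [T2Space X] (φ : C(X, ℝ) →L[ℝ] ℝ) {u : ℕ → C(X, ℝ)} {M : ℝ} (hM : ∀ n, ‖u n‖ ≤ M)
    (hu : ∀ x, Tendsto (fun n => u n x) atTop (𝓝 0)) :
    Tendsto (fun n => φ (u n)) atTop (𝓝 0) := by
  obtain ⟨Λ, hΛ⟩ := exists_positive_majorant φ
  let _ : MeasurableSpace X := borel X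
  have : BorelSpace X := ⟨rfl⟩
  let F : ℕ → C_c(X, ℝ≥0) := fun n =>
    { toFun := fun x => ‖u n x‖₊
      continuous_toFun := by fun_prop
      hasCompactSupport' := HasCompactSupport.of_compactSpace _ }
  have hF : ∀ n, (Λ (F n) : ℝ) = ∫ x, ‖u n x‖ ∂(NNRealRMK.rieszMeasure Λ) := fun n =>
    (NNRealRMK.integral_rieszMeasure Λ (F n)).symm
  have key : Tendsto (fun n => (Λ (F n) : ℝ)) atTop (𝓝 0) := by
    simp_rw [hF]
    have := tendsto_integral_of_dominated_convergence (μ := NNRealRMK.rieszMeasure Λ)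
      (F := fun n x => ‖u n x‖) (f := fun _ => 0) (fun _ => M)
      (fun n => (by fun_prop : Continuous fun x => ‖u n x‖).aestronglyMeasurable)
      (integrable_const M)
      (fun n => ae_of_all _ fun x => by simpa using ((u n).norm_coe_le_norm x).trans (hM n))
      (ae_of_all _ fun x => by simpa using (hu x).norm)
    simpa using this
  exact squeeze_zero_norm (fun n => hΛ (u n) (F n) fun x => le_rfl) key

theorem tendsto_toWeakSpace_iff {E ι : Type*} [NormedAddCommGroup E] [NormedSpace ℝ E]
    {l : Filter ι} {u : ι → E} {x : E} :
    Tendsto (fun i => toWeakSpace ℝ E (u i)) l (𝓝 (toWeakSpace ℝ E x)) ↔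
      ∀ φ : E →L[ℝ] ℝ, Tendsto (fun i => φ (u i)) l (𝓝 (φ x)) :=
  WeakBilin.tendsto_iff_forall_eval_tendsto (topDualPairing ℝ E).flip
    (fun _ _ h => (NormedSpace.inclusionInDoubleDualLi ℝ (E := E)).injective
      (ContinuousLinearMap.ext fun φ => congrArg (fun L => L φ) h))

theorem tendsto_toWeakSpace_of_pointwise {X : Type*} [TopologicalSpace X] [CompactSpace X]
    [T2Space X] {u : ℕ → C(X, ℝ)} {f : C(X, ℝ)} {M : ℝ} (hM : ∀ n, ‖u n‖ ≤ M)
    (hu : ∀ x, Tendsto (fun n => u n x) atTop (𝓝 (f x))) :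
    Tendsto (fun n => toWeakSpace ℝ C(X, ℝ) (u n)) atTop (𝓝 (toWeakSpace ℝ C(X, ℝ) f)) := by
  refine tendsto_toWeakSpace_iff.2 fun φ => ?_
  have := tendsto_functional_of_pointwise_zero φ (u := fun n => u n - f) (M := M + ‖f‖)
    (fun n => (norm_sub_le _ _).trans (by gcongr; exact hM n))
    (fun x => by simpa using (hu x).sub_const (f x))
  simpa using this.add_const (φ f)

theorem continuous_eval_weakSpace {X : Type*} [TopologicalSpace X] [CompactSpace X] (x : X) :
    Continuous fun w : WeakSpace ℝ C(X, ℝ) => (toWeakSpace ℝ C(X, ℝ)).symm w x :=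
  WeakBilin.eval_continuous (topDualPairing ℝ C(X, ℝ)).flip (ContinuousMap.evalCLM ℝ x)

/-! ### Sequences in pointwise closures over scattered spaces -/

/-- Pointwise closures of sets of continuous functions on a compact space are countably
determined. -/
theorem exists_countable_subset_mem_closure {X : Type*} [TopologicalSpace X] [CompactSpace X]
    {A : Set C(X, ℝ)} {f : C(X, ℝ)}
    (hf : (f : X → ℝ) ∈ closure ((fun g : C(X, ℝ) => (g : X → ℝ)) '' A)) :
    ∃ B ⊆ A, B.Countable ∧ (f : X → ℝ) ∈ closure ((fun g : C(X, ℝ) => (g : X → ℝ)) '' B) := by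
  -- Compactness of `Fin n → X` lets finitely many functions serve all `n`-tuples at tolerance `1 /
  -- (m + 1)`.
  have key : ∀ n m : ℕ, ∃ B ⊆ A, B.Finite ∧
      ∀ p : Fin n → X, ∃ g ∈ B, ∀ i, |g (p i) - f (p i)| < 1 / (m + 1 : ℝ) := by
    intro n m
    let U : C(X, ℝ) → Set (Fin n → X) := fun g => {p | ∀ i, |g (p i) - f (p i)| < 1 / (m + 1 : ℝ)}
    have hU : ∀ g, IsOpen (U g) := by
      intro g
      simp only [U, ofPred_forall]
      exact isOpen_iInter_of_finite fun i => isOpen_lt (by fun_prop) continuous_const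
    have hcov : (univ : Set (Fin n → X)) ⊆ ⋃ g ∈ A, U g := by
      intro p _
      have hopen : IsOpen {h : X → ℝ | ∀ i, |h (p i) - f (p i)| < 1 / (m + 1 : ℝ)} := by
        simp only [ofPred_forall]
        exact isOpen_iInter_of_finite fun i => isOpen_lt (by fun_prop) continuous_const
      obtain ⟨_, h, ⟨g, hg, rfl⟩⟩ := mem_closure_iff.1 hf _ hopen
        (by intro i; simp; positivity)
      exact mem_biUnion hg h
    obtain ⟨B, hBA, hBf, hB⟩ := isCompact_univ.elim_finite_subcover_image
      (fun g _ => hU g) hcov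
    refine ⟨B, hBA, hBf, fun p => ?_⟩
    simpa [U] using hB (mem_univ p)
  choose B hBA hBf hB using key
  refine ⟨⋃ n, ⋃ m, B n m, iUnion_subset fun n => iUnion_subset fun m => hBA n m,
    countable_iUnion fun n => countable_iUnion fun m => (hBf n m).countable, ?_⟩
  rw [mem_closure_iff_nhds]
  intro V hV
  rw [nhds_pi, Filter.mem_pi] at hV
  obtain ⟨I, hI, t, ht, hV⟩ := hV
  choose ε hε0 hε using fun i => Metric.mem_nhds_iff.1 (ht i)
  obtain ⟨δ, hδ0, hδ⟩ : ∃ δ > 0, ∀ i ∈ I, δ ≤ ε i := by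
    rcases I.eq_empty_or_nonempty with rfl | hne
    · exact ⟨1, one_pos, by simp⟩
    · obtain ⟨i, hi⟩ := hI.exists_minimalFor ε I hne
      refine ⟨ε i, hε0 i, fun j hj => ?_⟩
      rcases le_total (ε i) (ε j) with h | h
      · exact h
      · exact hi.2 hj h
  obtain ⟨m, hm⟩ := exists_nat_one_div_lt hδ0
  have := hI.fintype
  obtain ⟨g, hg, hgp⟩ := hB (Fintype.card I) m fun i => ((Fintype.equivFin I).symm i : X)
  refine ⟨g, hV fun i hi => hε i ?_, g, mem_iUnion.2 ⟨_, mem_iUnion.2 ⟨_, hg⟩⟩, rfl⟩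
  have := hgp (Fintype.equivFin I ⟨i, hi⟩)
  simp only [Equiv.symm_apply_apply] at this
  rw [Metric.mem_ball, Real.dist_eq]
  exact this.trans (hm.trans_le (hδ i hi))

/-- A nonempty Hausdorff continuous image of a compact scattered space has an isolated point. -/
theorem IsScattered.exists_isOpen_singleton.{u} {X Y : Type u} [TopologicalSpace X] [CompactSpace X]
    [TopologicalSpace Y] [T2Space Y] [Nonempty Y] (hX : IsScattered X) {p : X → Y}
    (hp : Continuous p) (hsurj : p.Surjective) : ∃ y : Y, IsOpen {y} := by
  -- Take `E` minimal closed with image `Y`. Removing an isolated point `x` of `E` leaves a compact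
  -- set whose image, by minimality, misses exactly `p x`.
  obtain ⟨E, hE, himg, hmin⟩ := exists_compact_surjective_zorn_subset hp hsurj
  have hne : E.Nonempty := by
    rw [← image_nonempty (f := p), himg]
    exact univ_nonempty
  have hpre := hX E hne
  simp only [preperfect_iff_nhds, not_forall, not_exists, not_and, not_not] at hpre
  obtain ⟨x, hxE, U, hU, hUx⟩ := hpre
  obtain ⟨W, hWU, hWo, hxW⟩ := mem_nhds_iff.1 hU
  have hcl : IsClosed ({⟨x, hxE⟩}ᶜ : Set E) := by
    rw [isClosed_compl_iff]
    convert hWo.preimage (continuous_subtype_val (p := (· ∈ E))) using 1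
    ext ⟨z, hz⟩
    simp only [mem_singleton_iff, Subtype.mk.injEq, mem_preimage]
    exact ⟨fun h => h ▸ hxW, fun h => hUx z ⟨hWU h, hz⟩⟩
  have hmin' := hmin {⟨x, hxE⟩}ᶜ (by simp) hcl
  have hclosed : IsClosed (E.domRestrict p '' {⟨x, hxE⟩}ᶜ) :=
    (hcl.isCompact.image (hp.comp continuous_subtype_val)).isClosed
  have hsub : (E.domRestrict p '' {⟨x, hxE⟩}ᶜ)ᶜ ⊆ {p x} := by
    intro y hy
    obtain ⟨z, hz, rfl⟩ : y ∈ p '' E := himg ▸ mem_univ y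
    by_contra hne
    exact hy ⟨⟨z, hz⟩, fun h => hne (by simpa using congrArg (fun t : E => p t) h), rfl⟩
  refine ⟨p x, ?_⟩
  rw [← hsub.antisymm (singleton_subset_iff.2 ?_)]
  · exact hclosed.isOpen_compl
  · obtain ⟨y, hy⟩ := (Set.nonempty_compl.2 hmin')
    rw [← show y = p x from hsub hy]
    exact hy

theorem IsScattered.subtype {X : Type*} [TopologicalSpace X] (hX : IsScattered X)
    (C : Set X) : IsScattered C := by
  intro A hA hpre
  refine hX (Subtype.val '' A) (hA.image _) ?_
  rw [preperfect_iff_nhds] at hpre ⊢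
  rintro _ ⟨x, hx, rfl⟩ U hU
  obtain ⟨y, ⟨hyU, hyA⟩, hne⟩ := hpre x hx _ (continuous_subtype_val.continuousAt hU)
  exact ⟨y, ⟨hyU, y, hyA, rfl⟩, fun h => hne (Subtype.ext h)⟩

/-- Continuous images of compact scattered spaces in second countable Hausdorff spaces are
countable. -/
theorem IsScattered.countable_range.{u} {X Y : Type u} [TopologicalSpace X] [CompactSpace X]
    [TopologicalSpace Y] [T2Space Y] [SecondCountableTopology Y] (hX : IsScattered X) {p : X → Y}
    (hp : Continuous p) : (range p).Countable := by
  by_contra hunc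
  -- An uncountable image would contain a nonempty perfect set, yet its preimage is compact and
  -- scattered, which forces an isolated point in it.
  obtain ⟨D, hD, hDne, hDp⟩ := exists_perfect_nonempty_of_isClosed_of_not_countable
    (isCompact_range hp).isClosed hunc
  have : Nonempty D := hDne.to_subtype
  have : CompactSpace (p ⁻¹' D) := isCompact_iff_compactSpace.1 (hD.closed.preimage hp).isCompact
  obtain ⟨⟨y, hy⟩, hyo⟩ := (hX.subtype (p ⁻¹' D)).exists_isOpen_singleton
    (p := D.restrictPreimage p) hp.restrictPreimage (by
      rintro ⟨y, hy⟩
      obtain ⟨x, rfl⟩ := hDp hy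
      exact ⟨⟨x, hy⟩, rfl⟩)
  obtain ⟨U, hU, hUy⟩ := isOpen_induced_iff.1 hyo
  have hyU : y ∈ U := by
    have : (⟨y, hy⟩ : D) ∈ Subtype.val ⁻¹' U := hUy ▸ rfl
    exact this
  obtain ⟨z, ⟨hzU, hzD⟩, hne⟩ := preperfect_iff_nhds.1 hD.acc y hy U (hU.mem_nhds hyU)
  have : (⟨z, hzD⟩ : D) ∈ ({⟨y, hy⟩} : Set D) := hUy ▸ hzU
  exact hne (congrArg Subtype.val this)

/-- Countably many continuous functions on a compact scattered space are determined by their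
values on a countable set. -/
theorem IsScattered.exists_countable_determining {X : Type*} [TopologicalSpace X] [CompactSpace X]
    (hX : IsScattered X) {B : Set C(X, ℝ)} (hB : B.Countable) :
    ∃ D : Set X, D.Countable ∧ ∀ x, ∃ d ∈ D, ∀ g ∈ B, g x = g d := by
  have := hB.to_subtype
  let p : X → B → ℝ := fun x g => g.1 x
  have hp : Continuous p := by fun_prop
  have := (hX.countable_range hp).to_subtype
  refine ⟨range (Set.rangeSplitting p), Set.countable_range _, fun x =>
    ⟨_, ⟨⟨p x, x, rfl⟩, rfl⟩, fun g hg => ?_⟩⟩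
  exact congrFun (Set.apply_rangeSplitting p ⟨p x, x, rfl⟩).symm ⟨g, hg⟩

/-- The pointwise topology on continuous functions on a compact scattered space has the
Fréchet–Urysohn property. -/
theorem IsScattered.exists_seq_pointwise {X : Type*} [TopologicalSpace X] [CompactSpace X]
    (hX : IsScattered X) {A : Set C(X, ℝ)} {f : C(X, ℝ)}
    (hf : (f : X → ℝ) ∈ closure ((fun g : C(X, ℝ) => (g : X → ℝ)) '' A)) :
    ∃ u : ℕ → C(X, ℝ), (∀ n, u n ∈ A) ∧ ∀ x, Tendsto (fun n => u n x) atTop (𝓝 (f x)) := by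
  obtain ⟨B, hBA, hBc, hfB⟩ := exists_countable_subset_mem_closure hf
  obtain ⟨D, hD, hdet⟩ := hX.exists_countable_determining (hBc.insert f)
  have := hD.to_subtype
  -- Restriction to the countable set `D` lands in a metrizable product, where closure is
  -- sequential; `D` determines the limit everywhere.
  have hr : Continuous (fun (h : X → ℝ) (d : D) => h d) := by fun_prop
  have h1 := image_closure_subset_closure_image hr (mem_image_of_mem _ hfB)
  obtain ⟨v, hv, hlim⟩ := mem_closure_iff_seq_limit.1 h1
  choose w hw hwv using hv
  choose u hu huw using hw
  refine ⟨u, fun n => hBA (hu n), fun x => ?_⟩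
  obtain ⟨d, hd, hxd⟩ := hdet x
  rw [hxd f (mem_insert _ _)]
  have : ∀ n, u n x = v n ⟨d, hd⟩ := fun n => by
    rw [hxd (u n) (mem_insert_of_mem _ (hu n)), ← hwv, ← huw]
  simp_rw [this]
  exact tendsto_pi_nhds.1 hlim ⟨d, hd⟩

/-- Norm-bounded subsets of `C(X, ℝ)`, for `X` compact scattered, are Fréchet–Urysohn in the weak
topology. -/
theorem IsScattered.exists_seq_tendsto_toWeakSpace {X : Type*} [TopologicalSpace X]
    [CompactSpace X] [T2Space X] (hX : IsScattered X) {A : Set C(X, ℝ)} {M : ℝ}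
    (hA : ∀ g ∈ A, ‖g‖ ≤ M) {f : C(X, ℝ)}
    (hf : toWeakSpace ℝ C(X, ℝ) f ∈ closure (toWeakSpace ℝ C(X, ℝ) '' A)) :
    ∃ u : ℕ → C(X, ℝ), (∀ n, u n ∈ A) ∧
      Tendsto (fun n => toWeakSpace ℝ C(X, ℝ) (u n)) atTop (𝓝 (toWeakSpace ℝ C(X, ℝ) f)) := by
  have hc : Continuous fun (w : WeakSpace ℝ C(X, ℝ)) (x : X) => (toWeakSpace ℝ C(X, ℝ)).symm w x :=
    continuous_pi continuous_eval_weakSpace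
  have h1 := image_closure_subset_closure_image hc (mem_image_of_mem _ hf)
  rw [image_image] at h1
  obtain ⟨u, hu, hlim⟩ := hX.exists_seq_pointwise (A := A) (f := f) h1
  exact ⟨u, hu, tendsto_toWeakSpace_of_pointwise (fun n => hA _ (hu n)) hlim⟩

/-! ### Failure of the Fréchet–Urysohn property in the full weak topology -/

theorem exists_norm_le_of_tendsto_toWeakSpace {E : Type*} [NormedAddCommGroup E]
    [NormedSpace ℝ E] {u : ℕ → E} {x : E}
    (hu : Tendsto (fun n => toWeakSpace ℝ E (u n)) atTop (𝓝 (toWeakSpace ℝ E x))) :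
    ∃ M, ∀ n, ‖u n‖ ≤ M := by
  rw [tendsto_toWeakSpace_iff] at hu
  obtain ⟨M, hM⟩ := banach_steinhaus (g := fun n => NormedSpace.inclusionInDoubleDual ℝ E (u n))
    fun φ => by
      obtain ⟨C, hC⟩ := (hu φ).norm.bddAbove_range
      exact ⟨C, fun i => hC ⟨i, rfl⟩⟩
  exact ⟨M, fun n => ((NormedSpace.inclusionInDoubleDualLi ℝ).norm_map (u n)).symm.le.trans (hM n)⟩

/-- Bumps living on disjoint open sets are pointwise null, hence weakly null, although each has norm
one. -/
theorem exists_seq_disjoint_bumps (X : Type*) [TopologicalSpace X] [CompactSpace X] [T2Space X]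
    [Infinite X] : ∃ (f : ℕ → C(X, ℝ)) (p : ℕ → X), (∀ n, ‖f n‖ ≤ 1) ∧ (∀ n x, 0 ≤ f n x) ∧
      (∀ n, f n (p n) = 1) ∧ ∀ x, ∀ᶠ n in atTop, f n x = 0 := by
  obtain ⟨U, hUi, hUo, hUd⟩ := exists_seq_infinite_isOpen_pairwise_disjoint X
  choose p hp using fun n => (hUi n).nonempty
  choose f hf0 hf1 hf using fun n => exists_continuous_zero_one_of_isClosed
    (hUo n).isClosed_compl (isClosed_singleton (x := p n)) (by simpa using hp n)
  refine ⟨f, p, fun n => (ContinuousMap.norm_le _ zero_le_one).2 fun x => ?_,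
    fun n x => (hf n x).1, fun n => hf1 n rfl, fun x => ?_⟩
  · rw [Real.norm_eq_abs, abs_of_nonneg (hf n x).1]
    exact (hf n x).2
  · by_cases h : ∃ m, x ∈ U m
    · obtain ⟨m, hm⟩ := h
      filter_upwards [eventually_gt_atTop m] with n hn
      exact hf0 n fun hx => disjoint_left.1 (hUd hn.ne) hm hx
    · exact Eventually.of_forall fun n => hf0 n fun hx => h ⟨n, hx⟩

/-- The weak topology of `C(X, ℝ)`, for `X` infinite, is not Fréchet–Urysohn. -/
theorem exists_zero_mem_weak_closure_no_seq (X : Type*) [TopologicalSpace X] [CompactSpace X]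
    [T2Space X] [Infinite X] :
    ∃ A : Set (WeakSpace ℝ C(X, ℝ)), 0 ∈ closure A ∧
      ∀ u : ℕ → WeakSpace ℝ C(X, ℝ), (∀ n, u n ∈ A) → ¬ Tendsto u atTop (𝓝 0) := by
  obtain ⟨f, p, hf1, hf0, hfp, hfx⟩ := exists_seq_disjoint_bumps X
  -- The iterated limit, `k → ∞` and then `n → ∞`, of `f n + n • f k` is zero. A single weakly
  -- convergent sequence is norm-bounded, which bounds `n`.
  refine ⟨range fun q : ℕ × ℕ => toWeakSpace ℝ C(X, ℝ) (f q.1 + (q.1 : ℝ) • f q.2), ?_, ?_⟩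
  · have hf : Tendsto (fun n => toWeakSpace ℝ C(X, ℝ) (f n)) atTop (𝓝 0) := by
      rw [← map_zero (toWeakSpace ℝ C(X, ℝ))]
      exact tendsto_toWeakSpace_of_pointwise hf1 fun x =>
        tendsto_const_nhds.congr' ((hfx x).mono fun n hn => hn.symm)
    refine isClosed_closure.mem_of_tendsto hf (Eventually.of_forall fun n => ?_)
    have h2 : Tendsto (fun k => toWeakSpace ℝ C(X, ℝ) (f n + (n : ℝ) • f k)) atTop
        (𝓝 (toWeakSpace ℝ C(X, ℝ) (f n))) := by
      simpa using (hf.const_smul (n : ℝ)).const_add (toWeakSpace ℝ C(X, ℝ) (f n))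
    exact mem_closure_of_tendsto h2 (Eventually.of_forall fun k => ⟨(n, k), rfl⟩)
  · intro u hu hlim
    choose q hq using hu
    obtain rfl : (fun j => toWeakSpace ℝ C(X, ℝ) (f (q j).1 + ((q j).1 : ℝ) • f (q j).2)) = u :=
      funext hq
    rw [← map_zero (toWeakSpace ℝ C(X, ℝ))] at hlim
    obtain ⟨M, hM⟩ := exists_norm_le_of_tendsto_toWeakSpace hlim
    obtain ⟨N, hN⟩ := exists_nat_ge M
    have hqN : ∀ j, (q j).1 ≤ N := by
      intro j
      have h1 := ((f (q j).1 + ((q j).1 : ℝ) • f (q j).2).norm_coe_le_norm (p (q j).2)).trans (hM j)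
      have h2 := (le_abs_self _).trans h1
      simp only [ContinuousMap.add_apply, ContinuousMap.smul_apply, hfp, smul_eq_mul,
        mul_one] at h2
      have h3 := hf0 (q j).1 (p (q j).2)
      exact_mod_cast (by linarith : ((q j).1 : ℝ) ≤ N)
    -- Only finitely many first indices `m` occur, and an element with first index `m` is at least
    -- `1` at `p m`.
    have hev : ∀ᶠ j in atTop, ∀ m ∈ Finset.range (N + 1),
        (f (q j).1 + ((q j).1 : ℝ) • f (q j).2) (p m) < 1 := by
      rw [Filter.eventually_all_finset]
      intro m _
      have := tendsto_toWeakSpace_iff.1 hlim (ContinuousMap.evalCLM ℝ (p m))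
      rw [map_zero] at this
      exact this.eventually_lt_const one_pos
    obtain ⟨j, hj⟩ := hev.exists
    have h := hj (q j).1 (Finset.mem_range.2 (Nat.lt_succ_of_le (hqN j)))
    simp only [ContinuousMap.add_apply, ContinuousMap.smul_apply, hfp, smul_eq_mul] at h
    have := mul_nonneg (Nat.cast_nonneg (α := ℝ) (q j).1) (hf0 (q j).2 (p (q j).1))
    linarith

/-! ### Baire category, embedding into a ball, and conclusion -/

theorem isClosed_weakSpace_norm_le {X : Type*} [TopologicalSpace X] [CompactSpace X] {M : ℝ}
    (hM : 0 ≤ M) :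
    IsClosed {w : WeakSpace ℝ C(X, ℝ) | ‖(toWeakSpace ℝ C(X, ℝ)).symm w‖ ≤ M} := by
  simp only [ContinuousMap.norm_le _ hM, ofPred_forall]
  exact isClosed_iInter fun x => isClosed_le (continuous_eval_weakSpace x).norm continuous_const

theorem continuous_toCp (X : Type*) [TopologicalSpace X] [CompactSpace X] :
    Continuous fun g : C(X, ℝ) => (⟨g, g.continuous⟩ : Cp X) :=
  Continuous.subtype_mk (continuous_pi fun x => by fun_prop) _

/-- Some sup-norm ball is mapped to a norm-bounded set by any continuous map from `C_p` to
`C_w`. -/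
theorem exists_ball_norm_le {K S : Type*} [TopologicalSpace K] [CompactSpace K]
    [TopologicalSpace S] [CompactSpace S] {h : Cp K → Cw S} (hh : Continuous h) :
    ∃ (f₀ : C(K, ℝ)) (r M : ℝ), 0 < r ∧ ∀ g : C(K, ℝ), ‖g - f₀‖ < r →
      ‖(toWeakSpace ℝ C(S, ℝ)).symm (h ⟨g, g.continuous⟩)‖ ≤ M := by
  -- Baire applies to the norm topology of `C(K, ℝ)`; the sets are closed there because it is finer
  -- than the pointwise topology.
  obtain ⟨n, f₀, hf₀⟩ := nonempty_interior_of_iUnion_of_closed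
    (f := fun n : ℕ => {g : C(K, ℝ) |
      ‖(toWeakSpace ℝ C(S, ℝ)).symm (h ⟨g, g.continuous⟩)‖ ≤ n})
    (fun n => (isClosed_weakSpace_norm_le n.cast_nonneg).preimage (hh.comp (continuous_toCp K)))
    (eq_univ_of_forall fun g => mem_iUnion.2 (exists_nat_ge
      ‖(toWeakSpace ℝ C(S, ℝ)).symm (h ⟨g, g.continuous⟩)‖))
  obtain ⟨r, hr, hball⟩ := Metric.mem_nhds_iff.1 (mem_interior_iff_mem_nhds.1 hf₀)
  exact ⟨f₀, r, n, hr, fun g hg => hball (by rwa [Metric.mem_ball, dist_eq_norm])⟩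

/-- `C_p(X)` embeds into each sup-norm ball. -/
theorem exists_isInducing_into_ball {X : Type*} [TopologicalSpace X] [CompactSpace X]
    (f₀ : C(X, ℝ)) {r : ℝ} (hr : 0 < r) :
    ∃ θ : Cp X → C(X, ℝ), IsInducing (fun u => (⟨θ u, (θ u).continuous⟩ : Cp X)) ∧
      ∀ u, ‖θ u - f₀‖ < r := by
  -- As `|arctan| < π / 2 ≤ 2`, the factor `r / 4` keeps the perturbation within `r / 2`; `tan`
  -- recovers `u` continuously.
  let θ : Cp X → C(X, ℝ) := fun u =>
    ⟨fun x => f₀ x + r / 4 * Real.arctan (u.1 x), by have := u.2; fun_prop⟩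
  let Θ : Cp X → Cp X := fun u => ⟨θ u, (θ u).continuous⟩
  refine ⟨θ, ?_, fun u => ?_⟩
  · change IsInducing Θ
    rw [isInducing_iff_nhds]
    intro u
    refine le_antisymm ?_ ?_
    · refine Tendsto.le_comap (Continuous.tendsto (Continuous.subtype_mk ?_ _) u)
      exact continuous_pi fun x => continuous_const.add (continuous_const.mul
        (Real.continuous_arctan.comp ((continuous_apply x).comp continuous_subtype_val)))
    · rw [nhds_subtype_eq_comap (x := u.1), ← tendsto_iff_comap, tendsto_pi_nhds]
      intro x
      have h1 : Tendsto (fun v : Cp X => (Θ v).1 x) (comap Θ (𝓝 (Θ u))) (𝓝 ((Θ u).1 x)) :=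
        (((continuous_apply x).comp continuous_subtype_val).tendsto (Θ u)).comp tendsto_comap
      have h2 := (h1.sub_const (f₀ x)).const_mul (4 / r)
      have e : ∀ v : Cp X, 4 / r * ((Θ v).1 x - f₀ x) = Real.arctan (v.1 x) := fun v => by
        simp only [Θ, θ, ContinuousMap.coe_mk]
        field_simp
        ring
      simp only [e] at h2
      have h3 := (Real.continuousAt_tan.2 (Real.cos_arctan_pos (u.1 x)).ne').tendsto.comp h2
      simpa only [Function.comp_def, Real.tan_arctan] using h3
  · refine lt_of_le_of_lt ((ContinuousMap.norm_le _ (C := r / 4 * 2) (by positivity)).2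
      fun x => ?_) (by linarith)
    simp only [θ, ContinuousMap.sub_apply, ContinuousMap.coe_mk, add_sub_cancel_left, norm_mul,
      Real.norm_eq_abs, abs_of_pos (show 0 < r / 4 by positivity)]
    gcongr
    rw [abs_le]
    constructor <;> linarith [Real.neg_pi_div_two_lt_arctan (u.1 x),
      Real.arctan_lt_pi_div_two (u.1 x), Real.pi_le_four]

theorem mainTheorem5
    (K : Type*) [TopologicalSpace K] [CompactSpace K] [T2Space K] [Infinite K]
    (S : Type*) [TopologicalSpace S] [CompactSpace S] [T2Space S] [Infinite S]
    (hS : IsScattered S) :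
    IsEmpty (Cp K ≃ₜ Cw S) := by
  refine ⟨fun h => ?_⟩
  obtain ⟨A, hA, hseq⟩ := exists_zero_mem_weak_closure_no_seq S
  obtain ⟨f₀, r, M, hr, hM⟩ := exists_ball_norm_le h.continuous
  obtain ⟨θ, hθ, hball⟩ := exists_isInducing_into_ball f₀ hr
  -- Conjugating `θ` by `h` embeds `Cw S` in a norm-bounded part of itself, so sequences found there
  -- pull back.
  let ψ : Cw S → C(S, ℝ) := fun w =>
    (toWeakSpace ℝ C(S, ℝ)).symm (h ⟨θ (h.symm w), (θ (h.symm w)).continuous⟩)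
  have hψ : IsInducing fun w => toWeakSpace ℝ C(S, ℝ) (ψ w) :=
    h.isInducing.comp (hθ.comp h.symm.isInducing)
  have hcl := image_closure_subset_closure_image hψ.continuous (mem_image_of_mem _ hA)
  rw [← image_image (toWeakSpace ℝ C(S, ℝ)) ψ] at hcl
  obtain ⟨u, hu, hlim⟩ := hS.exists_seq_tendsto_toWeakSpace (M := M)
    (by rintro _ ⟨w, -, rfl⟩; exact hM _ (hball _)) hcl
  choose v hv hvu using hu
  refine hseq v hv (hψ.tendsto_nhds_iff.2 ?_)
  simpa only [Function.comp_def, hvu] using hlim
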